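/- Fix a universal (optimal) prefix-free machine and let $K(\sigma)$ be the prefix-free Kolmogorov complexity of a finite binary string $\sigma$. For $X\in 2^\omega$ let $X\restriction n$ be its $n$-bit prefix, and let $\dim(X)=\liminf_{n\to\infty} K(X\restriction n)/n$ be its effective Hausdorff dimension. For $X,Y\in 2^\omega$ let $$d(X,Y)=\limsup_{n\to\infty}\frac{\#\{k<n : X(k)\ne Y(k)\}}{n},$$ and let $X\oplus Y$ be their join, $(X\oplus Y)(2i)=X(i)$, $(X\oplus Y)(2i+1)=Y(i)$. Call $Z\in 2^\omega$ Martin-Löf random if there is a constant $c$ such that $K(Z\restriction n)\ge n-c$ for all $n$. Let $H(p)=-(p\log_2 p+(1-p)\log_2(1-p))$ be the binary entropy function on $[0,1]$ (with $0\log_2 0=0$), and let $H^{-1}$ be the branch of its inverse that maps $[0,1]$ to $[0,1/2]$. Proposition. There is a sequence $Y\in 2^\omega$, of the form $Y=Z\oplus Z$ for a Martin-Löf random sequence $Z$, such that $\dim(Y)=1/2$ and every $X\in 2^\omega$ with $d(X,Y)\le H^{-1}(1/2)$ satisfies $\dim(X)>0$. Hence the naive entropy lower bound $H^{-1}(|\dim(Y)-\dim(X)|)$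 for the distance $d(X,Y)$ is not always optimal: for this $Y$, every $X$ with $\dim(X)=0$ satisfies $d(X,Y)>H^{-1}(|\dim(Y)-\dim(X)|)$. -/

import Mathlib

open Filter

namespace EffDim

/-! ### Prefix-free machines and prefix-free complexity -/

/-- A prefix-free machine: a partial computable function from binary strings to binary strings,
no two distinct elements of whose domain are comparable under the prefix order. -/
def IsPrefixFreeMachine (M : List Bool →. List Bool) : Prop :=
  Partrec M ∧ ∀ p q : List Bool, (M p).Dom → (M q).Dom → p <+: q → p = q

/-- An optimal prefix-free machine: it simulates every prefix-free machine with an additive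
constant overhead in the length of programs. -/
def IsOptimalPrefixFreeMachine (U : List Bool →. List Bool) : Prop :=
  IsPrefixFreeMachine U ∧
    ∀ M : List Bool →. List Bool, IsPrefixFreeMachine M →
      ∃ c : ℕ, ∀ p x : List Bool, x ∈ M p → ∃ q : List Bool, x ∈ U q ∧ q.length ≤ p.length + c

section Existence

open Encodable Nat.Partrec

/-- The `n`-th (program, output) pair enumerated by the machine with index `e`. -/
def item (e n : ℕ) : Option (List Bool × List Bool) :=
  (decode (α := List Bool) n.unpair.2).bind fun p =>
    ((Code.evaln n.unpair.1 (Denumerable.ofNat Code e) n.unpair.2).bind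
      (decode (α := List Bool))).map fun x => (p, x)

/-- The `m`-th pair enumerated by machine `e` has a program comparable with `p`. -/
def clash (e m : ℕ) (p : List Bool) : Bool :=
  Option.casesOn (item e m) false fun a => decide (a.1.take p.length = p.take a.1.length)

/-- The output of the `n`-th pair of machine `e`, provided that its program is `p` and that no
earlier pair has a program comparable with `p`. -/
def sel (e : ℕ) (p : List Bool) (n : ℕ) : Option (List Bool) :=
  if (item e n).map Prod.fst = some p ∧ ∀ m < n, clash e m p = false
  then (item e n).map Prod.snd else none

/-- One step of the universal machine: programs have the form `1^e 0 p`. -/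
def univStep (w : List Bool) (n : ℕ) : Option (List Bool) :=
  if w.findIdx (fun b => !b) < w.length
  then sel (w.findIdx fun b => !b) (w.drop (w.findIdx (fun b => !b) + 1)) n else none

/-- A universal prefix-free machine. -/
def univMachine (w : List Bool) : Part (List Bool) := Nat.rfindOpt (univStep w)

theorem item_prim : Primrec₂ item := by
  have hu : Primrec fun a : ℕ × ℕ => a.2.unpair := Primrec.unpair.comp Primrec.snd
  refine Primrec.option_bind (Primrec.decode.comp (Primrec.snd.comp hu)) ?_
  refine Primrec.option_map (f := fun b : (ℕ × ℕ) × List Bool =>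
    (Code.evaln b.1.2.unpair.1 (Denumerable.ofNat Code b.1.1) b.1.2.unpair.2).bind
      (decode (α := List Bool))) (g := fun b x => (b.2, x)) ?_ ?_
  · refine Primrec.option_bind ?_ (Primrec.decode.comp Primrec.snd)
    have hu' : Primrec fun b : (ℕ × ℕ) × List Bool => b.1.2.unpair := hu.comp Primrec.fst
    exact Code.primrec_evaln.comp (((Primrec.fst.comp hu').pair
      ((Primrec.ofNat Code).comp (Primrec.fst.comp Primrec.fst))).pair (Primrec.snd.comp hu'))
  · exact (Primrec.snd.comp Primrec.fst).pair Primrec.snd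

theorem clash_prim : Primrec fun a : (ℕ × ℕ) × List Bool => clash a.1.1 a.1.2 a.2 := by
  refine Primrec.option_casesOn (item_prim.comp (Primrec.fst.comp Primrec.fst)
    (Primrec.snd.comp Primrec.fst)) (Primrec.const false) ?_
  have h1 : Primrec fun a : ((ℕ × ℕ) × List Bool) × (List Bool × List Bool) =>
      a.2.1.take a.1.2.length :=
    Primrec.list_take.comp (Primrec.list_length.comp (Primrec.snd.comp Primrec.fst))
      (Primrec.fst.comp Primrec.snd)
  have h2 : Primrec fun a : ((ℕ × ℕ) × List Bool) × (List Bool × List Bool) =>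
      a.1.2.take a.2.1.length :=
    Primrec.list_take.comp (Primrec.list_length.comp (Primrec.fst.comp Primrec.snd))
      (Primrec.snd.comp Primrec.fst)
  exact (Primrec.eq.comp h1 h2).decide

theorem sel_prim : Primrec fun a : (ℕ × List Bool) × ℕ => sel a.1.1 a.1.2 a.2 := by
  have hi : Primrec fun a : (ℕ × List Bool) × ℕ => item a.1.1 a.2 :=
    item_prim.comp (Primrec.fst.comp Primrec.fst) Primrec.snd
  refine Primrec.ite (PrimrecPred.and ?_ ?_) (Primrec.option_map hi (Primrec.snd.comp Primrec.snd))
    (Primrec.const none)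
  · exact Primrec.eq.comp (Primrec.option_map hi (Primrec.fst.comp Primrec.snd))
      (Primrec.option_some.comp (Primrec.snd.comp Primrec.fst))
  · have hR : PrimrecRel fun (m : ℕ) (b : ℕ × List Bool) => clash b.1 m b.2 = false :=
      Primrec.eq.comp (clash_prim.comp (((Primrec.fst.comp Primrec.snd).pair Primrec.fst).pair
        (Primrec.snd.comp Primrec.snd))) (Primrec.const false)
    exact (hR.forall_mem_list.comp (Primrec.list_range.comp Primrec.snd) Primrec.fst).of_eq
      (by simp)

theorem univStep_prim : Primrec₂ univStep := by
  have hk : Primrec fun a : List Bool × ℕ => a.1.findIdx fun b => !b :=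
    Primrec.list_findIdx Primrec.fst (Primrec.not.comp Primrec.snd)
  refine Primrec.ite (Primrec.nat_lt.comp hk (Primrec.list_length.comp Primrec.fst)) ?_
    (Primrec.const none)
  exact sel_prim.comp ((hk.pair (Primrec.list_drop.comp (Primrec.succ.comp hk)
    Primrec.fst)).pair Primrec.snd)

theorem sel_spec {e n : ℕ} {p x : List Bool} (h : x ∈ sel e p n) :
    item e n = some (p, x) ∧ ∀ m < n, clash e m p = false := by
  unfold sel at h
  split_ifs at h with hc
  · refine ⟨?_, hc.2⟩
    obtain ⟨h1, -⟩ := hc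
    cases hi : item e n with
    | none => simp [hi] at h1
    | some a =>
      obtain ⟨q, y⟩ := a
      simp [hi] at h1 h
      simp [h1, h]
  · simp at h

theorem clash_of_item {e m : ℕ} {p q x : List Bool} (h : item e m = some (q, x))
    (hpq : p <+: q ∨ q <+: p) : clash e m p = true := by
  unfold clash
  rw [h]
  simp only [decide_eq_true_eq]
  rcases hpq with ⟨t, rfl⟩ | ⟨t, rfl⟩ <;> simp

theorem prefix_of_clash {e m : ℕ} {p : List Bool} (h : clash e m p = true) :
    ∃ q x, item e m = some (q, x) ∧ (p <+: q ∨ q <+: p) := by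
  unfold clash at h
  cases hi : item e m with
  | none => simp [hi] at h
  | some a =>
    obtain ⟨q, y⟩ := a
    simp only [hi, decide_eq_true_eq] at h
    refine ⟨q, y, rfl, ?_⟩
    rcases le_total p.length q.length with hl | hl
    · left
      rw [List.take_of_length_le hl] at h
      rw [← h]; exact List.take_prefix _ _
    · right
      rw [List.take_of_length_le hl] at h
      rw [h]; exact List.take_prefix _ _

theorem sel_prefixFree {e n n' : ℕ} {p p' x x' : List Bool} (h : x ∈ sel e p n)
    (h' : x' ∈ sel e p' n') (hpp : p <+: p') : p = p' := by
  obtain ⟨h1, h2⟩ := sel_spec h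
  obtain ⟨h1', h2'⟩ := sel_spec h'
  rcases lt_trichotomy n n' with hn | rfl | hn
  · simpa [clash_of_item h1 (Or.inr hpp)] using h2' n hn
  · rw [h1] at h1'; simp at h1'; exact h1'.1
  · simpa [clash_of_item h1' (Or.inl hpp)] using h2 n' hn

theorem parse {w : List Bool} (h : w.findIdx (fun b => !b) < w.length) :
    w = List.replicate (w.findIdx fun b => !b) true ++
      false :: w.drop (w.findIdx (fun b => !b) + 1) := by
  induction w with
  | nil => simp at h
  | cons b w ih =>
    cases b with
    | false => simp [List.findIdx_cons]
    | true =>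
      simp only [List.findIdx_cons, Bool.not_true, cond_false, List.length_cons,
        Nat.add_lt_add_iff_right] at h
      simp only [List.findIdx_cons, Bool.not_true, cond_false, List.replicate_succ,
        List.cons_append, List.drop_succ_cons]
      rw [← ih h]

theorem findIdx_unparse (e : ℕ) (p : List Bool) :
    (List.replicate e true ++ false :: p).findIdx (fun b => !b) = e := by
  induction e with
  | zero => simp [List.findIdx_cons]
  | succ e ih => simp [List.replicate_succ, List.findIdx_cons, ih]

theorem unparse_prefix {e e' : ℕ} {p p' : List Bool}
    (h : List.replicate e true ++ false :: p <+: List.replicate e' true ++ false :: p') :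
    e = e' ∧ p <+: p' := by
  induction e generalizing e' with
  | zero =>
    cases e' with
    | zero => simpa using h
    | succ e' => simp [List.replicate_succ] at h
  | succ e ih =>
    cases e' with
    | zero => simp [List.replicate_succ] at h
    | succ e' =>
      simp only [List.replicate_succ, List.cons_append, List.cons_prefix_cons, true_and] at h
      obtain ⟨h1, h2⟩ := ih h
      exact ⟨by rw [h1], h2⟩

theorem univMachine_dom {w : List Bool} (h : (univMachine w).Dom) :
    ∃ e p n x, w = List.replicate e true ++ false :: p ∧ x ∈ sel e p n := by
  obtain ⟨n, x, hx⟩ := Nat.rfindOpt_dom.1 h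
  unfold univStep at hx
  split_ifs at hx with hc
  · exact ⟨_, _, n, x, parse hc, hx⟩
  · simp at hx

theorem univMachine_isPrefixFree : IsPrefixFreeMachine univMachine := by
  refine ⟨Partrec.rfindOpt univStep_prim.to_comp, ?_⟩
  intro w w' hw hw' hpre
  obtain ⟨e, p, n, x, rfl, hx⟩ := univMachine_dom hw
  obtain ⟨e', p', n', x', rfl, hx'⟩ := univMachine_dom hw'
  obtain ⟨rfl, hp⟩ := unparse_prefix hpre
  rw [sel_prefixFree hx hx' hp]

theorem exists_index {M : List Bool →. List Bool} (hM : Partrec M) :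
    ∃ e : ℕ, (∀ n p x, item e n = some (p, x) → x ∈ M p) ∧
      ∀ p x, x ∈ M p → ∃ n, item e n = some (p, x) := by
  obtain ⟨c, hc⟩ := Code.exists_code.1 hM
  refine ⟨encode c, ?_, ?_⟩
  · intro n p x h
    simp only [item, Denumerable.ofNat_encode, Option.bind_eq_some_iff, Option.map_eq_some_iff,
      Prod.mk.injEq] at h
    obtain ⟨q, hq, y, ⟨z, hz, hzy⟩, rfl, rfl⟩ := h
    have := Code.evaln_sound (Option.mem_def.2 hz)
    rw [hc] at this
    simp [hq] at this
    obtain ⟨a, ha, rfl⟩ := this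
    simp at hzy
    rwa [← hzy]
  · intro p x h
    have : encode x ∈ c.eval (encode p) := by
      rw [hc]; simpa using h
    obtain ⟨k, hk⟩ := Code.evaln_complete.1 this
    refine ⟨Nat.pair k (encode p), ?_⟩
    simp [item, Option.mem_def.1 hk]

theorem univMachine_isOptimal : IsOptimalPrefixFreeMachine univMachine := by
  refine ⟨univMachine_isPrefixFree, ?_⟩
  intro M ⟨hM, hpf⟩
  obtain ⟨e, he1, he2⟩ := exists_index hM
  refine ⟨e + 1, fun p x hx => ⟨List.replicate e true ++ false :: p, ?_, ?_⟩⟩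
  · have hex : ∃ n y, item e n = some (p, y) := by
      obtain ⟨n, hn⟩ := he2 p x hx
      exact ⟨n, x, hn⟩
    classical
    obtain ⟨y, hy⟩ := Nat.find_spec hex
    have hmin := fun m (hm : m < Nat.find hex) => Nat.find_min hex hm
    have hsel : y ∈ sel e p (Nat.find hex) := by
      unfold sel
      rw [if_pos]
      · simp [hy]
      · refine ⟨by simp [hy], fun m hm => ?_⟩
        by_contra hcl
        obtain ⟨q, z, hq, hqp⟩ := prefix_of_clash (by simpa using hcl)
        have hzM := he1 _ _ _ hq
        have hqp' : p = q := by
          rcases hqp with h | h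
          · exact hpf p q (Part.dom_iff_mem.2 ⟨_, hx⟩) (Part.dom_iff_mem.2 ⟨_, hzM⟩) h
          · exact (hpf q p (Part.dom_iff_mem.2 ⟨_, hzM⟩) (Part.dom_iff_mem.2 ⟨_, hx⟩) h).symm
        subst hqp'
        exact hmin m hm ⟨z, hq⟩
    have hstep : ∀ n, univStep (List.replicate e true ++ false :: p) n = sel e p n := by
      intro n
      unfold univStep
      rw [findIdx_unparse, if_pos (by simp)]
      congr 1
      simp [List.drop_append]
    have hdom : (univMachine (List.replicate e true ++ false :: p)).Dom :=
      Nat.rfindOpt_dom.2 ⟨_, y, by rw [hstep]; exact hsel⟩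
    obtain ⟨z, hz⟩ := Part.dom_iff_mem.1 hdom
    obtain ⟨n, hn⟩ := Nat.rfindOpt_spec hz
    rw [hstep] at hn
    have hzM := he1 _ _ _ (sel_spec hn).1
    rwa [Part.mem_unique hx hzM]
  · simp; omega

end Existence

/-- The prefix-free Kolmogorov complexity `K σ`: the length of a shortest program for `σ` on the
universal prefix-free machine. -/
noncomputable def K (σ : List Bool) : ℕ :=
  sInf {n : ℕ | ∃ p : List Bool, σ ∈ univMachine p ∧ p.length = n}

/-! ### Infinite sequences -/

/-- The `n`-bit prefix of an infinite binary sequence. -/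
def prefixOf (X : ℕ → Bool) (n : ℕ) : List Bool := (List.range n).map X

/-- The effective (Hausdorff) dimension `liminf K(X↾n) / n`. -/
noncomputable def effDim (X : ℕ → Bool) : ℝ :=
  liminf (fun n : ℕ => (K (prefixOf X n) : ℝ) / n) atTop

/-- The Besicovitch distance: the upper density of the set of places where `X` and `Y` differ. -/
noncomputable def besicovitchDist (X Y : ℕ → Bool) : ℝ :=
  limsup (fun n : ℕ => (((Finset.range n).filter fun k => X k ≠ Y k).card : ℝ) / n) atTop

/-- Martin-Löf randomness: `K(X↾n) ≥ n - O(1)`. -/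
def IsMLRandom (X : ℕ → Bool) : Prop :=
  ∃ c : ℕ, ∀ n : ℕ, n ≤ K (prefixOf X n) + c

/-- The join `X ⊕ Y`, with `X` on the even and `Y` on the odd places. -/
def join (X Y : ℕ → Bool) (n : ℕ) : Bool := if n % 2 = 0 then X (n / 2) else Y (n / 2)

/-- The binary entropy function, with logarithms to base 2. -/
noncomputable def H (p : ℝ) : ℝ := -(p * Real.logb 2 p + (1 - p) * Real.logb 2 (1 - p))

/-- The branch of the inverse of `H` that maps `[0,1]` to `[0,1/2]`. -/
noncomputable def Hinv : ℝ → ℝ := Function.invFunOn H (Set.Icc 0 (1 / 2))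

end EffDim

namespace EffDim

/-!
By Kraft's inequality `∑ 2 ^ (-K σ) ≤ 1`, so Borel-Cantelli shows that almost every fair coin
sequence has only finitely many prefixes `σ` with `K σ < |σ|`; let `Z` be such a sequence. Since
`Z ⊕ Z` repeats every bit of `Z` in place, `dim (Z ⊕ Z) = dim Z / 2 = 1/2`. If `X` is at
distance `d` from `Z ⊕ Z`, then the even and the odd half of `X` approximate `Z` with error
densities averaging to at most `d`. Correcting such an approximation costs half a bit per symbol
plus two bits per error, so averaging over the two halves gives `dim Z / 2 ≤ dim X + d + 1/4`,
that is, `1/4 ≤ dim X + d`. Finally `H⁻¹(1/2) < 1/4`, because `H(1/4) > 1/2`.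
-/

/-! ### Effectively enumerated machines -/

/-- The graph of a prefix-free machine, presented by a computable enumeration of (program, output)
pairs. Such an enumeration is easier to write down than a machine, since a program need not be
parsed; the index type is arbitrary so that a search over tuples needs no coding. -/
def IsPrefixFreeEnum {α : Type*} [Primcodable α] (f : α → Option (List Bool × List Bool)) : Prop :=
  Computable f ∧
    ∀ a b p q x y, f a = some (p, x) → f b = some (q, y) → p <+: q → p = q ∧ x = y

theorem IsPrefixFreeEnum.exists_isPrefixFreeMachine {α : Type*} [Primcodable α]
    {f : α → Option (List Bool × List Bool)} (hf : IsPrefixFreeEnum f) :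
    ∃ M, IsPrefixFreeMachine M ∧ ∀ a p x, f a = some (p, x) → x ∈ M p := by
  let output (p : List Bool) (a : α) : Option (List Bool) :=
    (f a).bind fun px => if px.1 = p then some px.2 else none
  let step (p : List Bool) (n : ℕ) : Option (List Bool) :=
    (Encodable.decode (α := α) n).bind (output p)
  have mem_output {p a x} : x ∈ output p a ↔ f a = some (p, x) := by
    rcases h : f a with _ | ⟨q, y⟩ <;> simp [output, h]
  have exists_of_mem_step {p n x} (h : x ∈ step p n) : ∃ a, f a = some (p, x) :=
    let ⟨a, _, ha⟩ := Option.bind_eq_some_iff.1 h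
    ⟨a, mem_output.1 ha⟩
  have mem_step {a p x} (h : f a = some (p, x)) : x ∈ step p (Encodable.encode a) := by
    simpa only [step, Encodable.encodek, Option.bind_some] using mem_output.2 h
  have output_computable : Computable₂ output := by
    refine Computable.option_bind (hf.1.comp Computable.snd) (Primrec.to_comp ?_)
    exact Primrec.ite (Primrec.eq.comp (Primrec.fst.comp Primrec.snd)
      (Primrec.fst.comp Primrec.fst)) (Primrec.option_some.comp (Primrec.snd.comp Primrec.snd))
      (Primrec.const none)
  have step_computable : Computable₂ step := Computable.bind_decode_iff.2 output_computable
  refine ⟨fun p => Nat.rfindOpt (step p), ⟨Partrec.rfindOpt step_computable, ?_⟩, ?_⟩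
  · intro p q hp hq hpq
    obtain ⟨_, x, hx⟩ := Nat.rfindOpt_dom.1 hp
    obtain ⟨_, y, hy⟩ := Nat.rfindOpt_dom.1 hq
    obtain ⟨a, ha⟩ := exists_of_mem_step hx
    obtain ⟨b, hb⟩ := exists_of_mem_step hy
    exact (hf.2 a b p q x y ha hb hpq).1
  · intro a p x hx
    obtain ⟨y, hy⟩ := Part.dom_iff_mem.1 (Nat.rfindOpt_dom.2 ⟨_, x, mem_step hx⟩)
    obtain ⟨_, hn⟩ := Nat.rfindOpt_spec hy
    obtain ⟨b, hb⟩ := exists_of_mem_step hn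
    rwa [(hf.2 a b p p x y hx hb List.prefix_rfl).2]

theorem IsPrefixFreeMachine.exists_isPrefixFreeEnum {M : List Bool →. List Bool}
    (hM : IsPrefixFreeMachine M) :
    ∃ f : ℕ → Option (List Bool × List Bool),
      IsPrefixFreeEnum f ∧ ∀ p x, x ∈ M p → ∃ n, f n = some (p, x) := by
  obtain ⟨e, sound, complete⟩ := exists_index hM.1
  refine ⟨item e, ⟨(item_prim.comp (Primrec.const e) Primrec.id).to_comp, ?_⟩, complete⟩
  intro m n p q x y hm hn hpq
  have hx : x ∈ M p := sound m p x hm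
  have hy : y ∈ M q := sound n q y hn
  obtain rfl : p = q := hM.2 p q (Part.dom_iff_mem.2 ⟨x, hx⟩) (Part.dom_iff_mem.2 ⟨y, hy⟩) hpq
  exact ⟨rfl, Part.mem_unique hx hy⟩

theorem IsPrefixFreeEnum.exists_univMachine_program {α : Type*} [Primcodable α]
    {f : α → Option (List Bool × List Bool)} (hf : IsPrefixFreeEnum f) :
    ∃ c : ℕ, ∀ a p x, f a = some (p, x) →
      ∃ q, x ∈ univMachine q ∧ q.length ≤ p.length + c := by
  obtain ⟨M, hM, hfM⟩ := hf.exists_isPrefixFreeMachine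
  obtain ⟨c, hc⟩ := univMachine_isOptimal.2 M hM
  exact ⟨c, fun a p x h => hc p x (hfM a p x h)⟩

/-! ### Upper bounds for the complexity -/

/-- A self-delimiting description of `σ`: its length `n` is given by the unary codes of the two
components of `Nat.unpair n`, which are at most `√n`. -/
def delimit (σ : List Bool) : List Bool :=
  List.replicate σ.length.unpair.1 true ++ false ::
    (List.replicate σ.length.unpair.2 true ++ false :: σ)

theorem delimit_primrec : Primrec delimit := by
  have unary : Primrec₂ fun (n : ℕ) (σ : List Bool) => List.replicate n true ++ false :: σ := by
    refine (Primrec.list_append.comp (Primrec.list_map (Primrec.list_range.comp Primrec.fst)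
      (Primrec.const true).to₂) (Primrec.list_cons.comp (Primrec.const false) Primrec.snd)).of_eq
      fun a => ?_
    rw [List.map_const', List.length_range]
  have unpair_length : Primrec fun σ : List Bool => σ.length.unpair :=
    Primrec.unpair.comp Primrec.list_length
  exact unary.comp (Primrec.fst.comp unpair_length)
    (unary.comp (Primrec.snd.comp unpair_length) Primrec.id)

theorem eq_of_prefix_delimit {σ τ : List Bool} (h : delimit σ <+: delimit τ) : σ = τ := by
  obtain ⟨h₁, h⟩ := unparse_prefix h
  obtain ⟨h₂, h⟩ := unparse_prefix h
  refine h.eq_of_length ?_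
  rw [← Nat.pair_unpair σ.length, h₁, h₂, Nat.pair_unpair]

theorem length_delimit_le (σ : List Bool) :
    (delimit σ).length ≤ σ.length + 2 * Nat.sqrt σ.length + 2 := by
  have hmax := Nat.max_sq_add_min_le_pair σ.length.unpair.1 σ.length.unpair.2
  rw [Nat.pair_unpair] at hmax
  have hsqrt : max σ.length.unpair.1 σ.length.unpair.2 ≤ Nat.sqrt σ.length :=
    Nat.le_sqrt'.2 (by omega)
  simp only [delimit, List.length_append, List.length_replicate, List.length_cons]
  omega

theorem exists_univMachine_program_length_le :
    ∃ c : ℕ, ∀ σ, ∃ p, σ ∈ univMachine p ∧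
      p.length ≤ σ.length + 2 * Nat.sqrt σ.length + c := by
  have enum : IsPrefixFreeEnum fun σ => some (delimit σ, σ) := by
    refine ⟨Computable.option_some.comp (delimit_primrec.to_comp.pair Computable.id), ?_⟩
    rintro σ τ _ _ _ _ ⟨⟩ ⟨⟩ h
    obtain rfl := eq_of_prefix_delimit h
    exact ⟨rfl, rfl⟩
  obtain ⟨c, hc⟩ := enum.exists_univMachine_program
  refine ⟨c + 2, fun σ => ?_⟩
  obtain ⟨p, hp, hpc⟩ := hc σ _ _ rfl
  exact ⟨p, hp, by have := length_delimit_le σ; omega⟩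

theorem K_le_length_of_mem {σ p : List Bool} (h : σ ∈ univMachine p) : K σ ≤ p.length :=
  Nat.sInf_le ⟨p, h, rfl⟩

theorem exists_shortest_program (σ : List Bool) : ∃ p, σ ∈ univMachine p ∧ p.length = K σ := by
  obtain ⟨_, hc⟩ := exists_univMachine_program_length_le
  obtain ⟨p, hp, -⟩ := hc σ
  exact Nat.sInf_mem (s := {n | ∃ p, σ ∈ univMachine p ∧ p.length = n}) ⟨p.length, p, hp, rfl⟩

theorem exists_K_le_length_add_sqrt :
    ∃ c : ℕ, ∀ σ, K σ ≤ σ.length + 2 * Nat.sqrt σ.length + c := by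
  obtain ⟨c, hc⟩ := exists_univMachine_program_length_le
  refine ⟨c, fun σ => ?_⟩
  obtain ⟨p, hp, hpc⟩ := hc σ
  exact (K_le_length_of_mem hp).trans hpc

theorem IsPrefixFreeEnum.exists_K_le_length {α : Type*} [Primcodable α]
    {f : α → Option (List Bool × List Bool)} (hf : IsPrefixFreeEnum f) :
    ∃ c : ℕ, ∀ a p x, f a = some (p, x) → K x ≤ p.length + c := by
  obtain ⟨c, hc⟩ := hf.exists_univMachine_program
  refine ⟨c, fun a p x h => ?_⟩
  obtain ⟨q, hq, hqc⟩ := hc a p x h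
  exact (K_le_length_of_mem hq).trans hqc

theorem IsPrefixFreeEnum.append_code {α : Type*} [Primcodable α]
    {f : α → Option (List Bool × List Bool)} (hf : IsPrefixFreeEnum f)
    {code : List Bool → List Bool → Option (List Bool)} (hcode : Computable₂ code)
    (hpf : ∀ x z z' r r', code x z = some r → code x z' = some r' → r <+: r' → z = z') :
    IsPrefixFreeEnum fun a : α × List Bool =>
      (f a.1).bind fun px => (code px.2 a.2).map fun r => (px.1 ++ r, a.2) := by
  constructor
  · refine Computable.option_bind (hf.1.comp Computable.fst) (Computable.option_map
      (hcode.comp (Computable.snd.comp Computable.snd) (Computable.snd.comp Computable.fst)) ?_)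
    exact (Computable.list_append.comp (Computable.fst.comp (Computable.snd.comp Computable.fst))
      Computable.snd).pair (Computable.snd.comp (Computable.fst.comp Computable.fst))
  · rintro ⟨a, z⟩ ⟨b, z'⟩ w w' y y' h h' hw
    simp only [Option.bind_eq_some_iff, Option.map_eq_some_iff, Prod.mk.injEq] at h h'
    obtain ⟨⟨p, x⟩, hp, r, hr, rfl, rfl⟩ := h
    obtain ⟨⟨p', x'⟩, hp', r', hr', rfl, rfl⟩ := h'
    obtain ⟨rfl, rfl⟩ : p = p' ∧ x = x' := by
      rcases List.prefix_or_prefix_of_prefix ((List.prefix_append p r).trans hw)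
        (List.prefix_append p' r') with hpp | hpp
      · exact hf.2 _ _ _ _ _ _ hp hp' hpp
      · exact (hf.2 _ _ _ _ _ _ hp' hp hpp).imp Eq.symm Eq.symm
    obtain rfl := hpf x z z' r r' hr hr' ((List.prefix_append_right_inj p).1 hw)
    exact ⟨by rw [Option.some.inj (hr.symm.trans hr')], rfl⟩

theorem exists_K_le_K_add_length_code {code : List Bool → List Bool → Option (List Bool)}
    (hcode : Computable₂ code)
    (hpf : ∀ x z z' r r', code x z = some r → code x z' = some r' → r <+: r' → z = z') :
    ∃ c : ℕ, ∀ x z r, code x z = some r → K z ≤ K x + r.length + c := by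
  obtain ⟨f, hf, hfU⟩ := univMachine_isPrefixFree.exists_isPrefixFreeEnum
  obtain ⟨c, hc⟩ := (hf.append_code hcode hpf).exists_K_le_length
  refine ⟨c, fun x z r hr => ?_⟩
  obtain ⟨p, hp, hpK⟩ := exists_shortest_program x
  obtain ⟨n, hn⟩ := hfU p x hp
  rw [← hpK, ← List.length_append]
  exact hc (n, z) (p ++ r) z (by simp only [hn, hr, Option.bind_some, Option.map_some])

theorem exists_K_map_le {F : List Bool → List Bool} (hF : Computable F) :
    ∃ c : ℕ, ∀ x, K (F x) ≤ K x + c := by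
  obtain ⟨c, hc⟩ := exists_K_le_K_add_length_code
    (code := fun x z => bif decide (z = F x) then some [] else none)
    (Computable.cond (Primrec.eq.decide.to_comp.comp Computable.snd (hF.comp Computable.fst))
      (Computable.const _) (Computable.const _))
    (by
      simp only [Bool.cond_decide, Option.ite_none_right_eq_some]
      rintro x z z' r r' ⟨rfl, -⟩ ⟨rfl, -⟩ -
      rfl)
  exact ⟨c, fun x => by simpa using hc x (F x) [] (by simp)⟩

/-! ### Martin-Löf random sequences -/

section Random

open InformationTheory MeasureTheory ProbabilityTheory
open scoped ENNReal

theorem uniquelyDecodable_of_prefixFree {α : Type*} {S : Set (List α)}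
    (nil_notMem : [] ∉ S) (hS : IsAntichain (· <+: ·) S) : UniquelyDecodable S := by
  intro l
  induction l with
  | nil =>
    rintro (_ | ⟨q, l'⟩) - hl' h
    · rfl
    · obtain rfl : q = [] := (List.append_eq_nil_iff.1 h.symm).1
      exact absurd (hl' [] List.mem_cons_self) nil_notMem
  | cons p l ih =>
    rintro (_ | ⟨q, l'⟩) hl hl' h
    · obtain rfl : p = [] := (List.append_eq_nil_iff.1 h).1
      exact absurd (hl [] List.mem_cons_self) nil_notMem
    · rw [List.forall_mem_cons] at hl hl'
      rw [List.flatten_cons, List.flatten_cons] at h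
      obtain rfl : p = q := by
        rcases List.prefix_or_prefix_of_prefix (List.prefix_append p l.flatten)
          (h ▸ List.prefix_append q l'.flatten) with hpq | hqp
        · exact hS.eq hl.1 hl'.1 hpq
        · exact (hS.eq hl'.1 hl.1 hqp).symm
      rw [ih l' hl.2 hl'.2 (List.append_cancel_left h)]

theorem uniquelyDecodable_setOf_univMachine_dom :
    UniquelyDecodable {p | (univMachine p).Dom} := by
  refine uniquelyDecodable_of_prefixFree (fun h => ?_) fun p hp q hq hne hpq =>
    hne (univMachine_isPrefixFree.2 p q hp hq hpq)
  obtain ⟨e, p, _, _, hw, -⟩ := univMachine_dom h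
  simp at hw

theorem tsum_two_inv_pow_K_le_one : ∑' σ, (2⁻¹ : ℝ≥0∞) ^ K σ ≤ 1 := by
  choose π hπ hlength using exists_shortest_program
  have hinj : Function.Injective π := fun σ τ h => Part.mem_unique (hπ σ) (h ▸ hπ τ)
  refine ENNReal.summable.tsum_le_of_sum_le fun s => ?_
  have huniq : UniquelyDecodable (s.image π : Set (List Bool)) := fun l l' hl hl' =>
    have hdom : ∀ p ∈ (s.image π : Set (List Bool)), (univMachine p).Dom := by
      simp only [Finset.coe_image, Set.forall_mem_image]
      exact fun σ _ => Part.dom_iff_mem.2 ⟨σ, hπ σ⟩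
    uniquelyDecodable_setOf_univMachine_dom l l' (fun p hp => hdom p (hl p hp))
      fun p hp => hdom p (hl' p hp)
  have hkraft : ∑ σ ∈ s, (2⁻¹ : ℝ) ^ K σ ≤ 1 := by
    simpa only [Finset.sum_image hinj.injOn, hlength, Fintype.card_bool, one_div, Nat.cast_ofNat]
      using kraft_mcmillan_inequality huniq
  have hterm (σ : List Bool) : (2⁻¹ : ℝ≥0∞) ^ K σ = ENNReal.ofReal ((2⁻¹ : ℝ) ^ K σ) := by
    rw [ENNReal.ofReal_pow (by norm_num), ENNReal.ofReal_inv_of_pos (by norm_num),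
      ENNReal.ofReal_ofNat]
  simp_rw [hterm]
  rw [← ENNReal.ofReal_sum_of_nonneg fun _ _ => by positivity]
  exact ENNReal.ofReal_le_one.2 hkraft

@[simp]
theorem length_prefixOf (X : ℕ → Bool) (n : ℕ) : (prefixOf X n).length = n := by
  simp only [prefixOf, List.length_map, List.length_range]

theorem prefixOf_inj {X Y : ℕ → Bool} {n : ℕ} :
    prefixOf X n = prefixOf Y n ↔ ∀ i < n, X i = Y i := by
  simp only [prefixOf, List.map_inj_left, List.mem_range]

theorem getD_prefixOf {X : ℕ → Bool} {n i : ℕ} (h : i < n) (d : Bool) :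
    (prefixOf X n).getD i d = X i := by
  rw [List.getD_eq_getElem _ _ (by rwa [length_prefixOf])]
  simp only [prefixOf, List.getElem_map, List.getElem_range]

theorem prefixOf_getD (σ : List Bool) (d : Bool) :
    prefixOf (fun i => σ.getD i d) σ.length = σ := by
  refine List.ext_getElem (length_prefixOf _ _) fun i _ hi => ?_
  simp only [prefixOf, List.getElem_map, List.getElem_range, List.getD_eq_getElem _ _ hi]

/-- The distribution of a sequence of independent tosses of a fair coin. -/
noncomputable def fairCoin : Measure (ℕ → Bool) :=
  Measure.infinitePi fun _ => uniformOn Set.univ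

instance : IsProbabilityMeasure fairCoin :=
  inferInstanceAs (IsProbabilityMeasure (Measure.infinitePi _))

theorem fairCoin_cylinder (σ : List Bool) :
    fairCoin {X | prefixOf X σ.length = σ} = 2⁻¹ ^ σ.length := by
  have hpi : {X | prefixOf X σ.length = σ} =
      Set.pi (Finset.range σ.length) fun i => {σ.getD i false} := by
    ext X
    calc prefixOf X σ.length = σ
      _ ↔ prefixOf X σ.length = prefixOf (fun i => σ.getD i false) σ.length := by
        rw [prefixOf_getD]
      _ ↔ X ∈ Set.pi (Finset.range σ.length) fun i => {σ.getD i false} := by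
        simp only [prefixOf_inj, Set.mem_pi, Finset.coe_range, Set.mem_Iio,
          Set.mem_singleton_iff]
  have hsingleton (b : Bool) : uniformOn Set.univ {b} = (2⁻¹ : ℝ≥0∞) := by
    rw [uniformOn_univ, Measure.count_singleton, Fintype.card_bool, Nat.cast_ofNat, one_div]
  rw [hpi, fairCoin, Measure.infinitePi_pi _ fun _ _ => measurableSet_singleton _]
  simp only [hsingleton, Finset.prod_const, Finset.card_range]

theorem ae_isMLRandom : ∀ᵐ Z ∂fairCoin, IsMLRandom Z := by
  let bad (σ : List Bool) : Set (ℕ → Bool) := {Z | prefixOf Z σ.length = σ ∧ K σ < σ.length}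
  have measure_bad_le (σ : List Bool) : fairCoin (bad σ) ≤ 2⁻¹ ^ K σ := by
    by_cases h : K σ < σ.length
    · calc fairCoin (bad σ) ≤ fairCoin {X | prefixOf X σ.length = σ} :=
            measure_mono fun _ hZ => hZ.1
        _ = 2⁻¹ ^ σ.length := fairCoin_cylinder σ
        _ ≤ 2⁻¹ ^ K σ := pow_le_pow_right_of_le_one' (by simp) h.le
    · simp [bad, h]
  have tsum_measure_bad : ∑' σ, fairCoin (bad σ) ≠ ∞ :=
    ((ENNReal.tsum_le_tsum measure_bad_le).trans tsum_two_inv_pow_K_le_one).trans_lt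
      ENNReal.one_lt_top |>.ne
  filter_upwards [ae_finite_setOfPred_mem tsum_measure_bad] with Z hZ
  obtain ⟨c, hc⟩ := (hZ.image List.length).bddAbove
  refine ⟨c, fun n => ?_⟩
  by_contra! h
  have hbad : Z ∈ bad (prefixOf Z n) := ⟨by rw [length_prefixOf], by rw [length_prefixOf]; omega⟩
  have : n ≤ c := by simpa using hc (Set.mem_image_of_mem List.length hbad)
  omega

theorem exists_isMLRandom : ∃ Z, IsMLRandom Z := ae_isMLRandom.exists

end Random

/-! ### Effective dimension -/

section Dimension

variable {X Z : ℕ → Bool} {a : ℝ}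

theorem isBoundedUnder_le_K_div (X : ℕ → Bool) :
    IsBoundedUnder (· ≤ ·) atTop fun n : ℕ => (K (prefixOf X n) : ℝ) / n := by
  obtain ⟨c, hc⟩ := exists_K_le_length_add_sqrt
  refine isBoundedUnder_of_eventually_le (a := 3 + c) ?_
  filter_upwards [eventually_ge_atTop 1] with n hn
  have hK : K (prefixOf X n) ≤ (3 + c) * n := by
    have := hc (prefixOf X n)
    rw [length_prefixOf] at this
    nlinarith [Nat.sqrt_le_self n]
  rw [div_le_iff₀ (by positivity)]
  exact_mod_cast hK

theorem isBoundedUnder_ge_K_div (X : ℕ → Bool) :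
    IsBoundedUnder (· ≥ ·) atTop fun n : ℕ => (K (prefixOf X n) : ℝ) / n :=
  isBoundedUnder_of_eventually_ge (a := 0) (Eventually.of_forall fun n => by positivity)

theorem eventually_mul_le_K_of_lt_effDim (h : a < effDim X) :
    ∀ᶠ n : ℕ in atTop, a * n ≤ K (prefixOf X n) := by
  filter_upwards [eventually_lt_of_lt_liminf h (isBoundedUnder_ge_K_div X),
    eventually_gt_atTop 0] with n hn hpos
  exact ((lt_div_iff₀ (by positivity)).1 hn).le

theorem frequently_K_le_mul_of_effDim_lt (h : effDim X < a) :
    ∃ᶠ n : ℕ in atTop, (K (prefixOf X n) : ℝ) ≤ a * n := by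
  have hlt := frequently_lt_of_liminf_lt (isBoundedUnder_le_K_div X).isCoboundedUnder_ge h
  refine (hlt.and_eventually (eventually_gt_atTop 0)).mono fun n hn => ?_
  obtain ⟨hn, hpos⟩ := hn
  exact ((div_lt_iff₀ (by positivity)).1 hn).le

theorem le_effDim (C : ℝ) (h : ∀ᶠ n : ℕ in atTop, a * n ≤ K (prefixOf X n) + C) :
    a ≤ effDim X := by
  by_contra! hlt
  obtain ⟨b, hXb, hba⟩ := exists_between hlt
  have hlarge : ∀ᶠ n : ℕ in atTop, C < (a - b) * n :=
    (tendsto_natCast_atTop_atTop.const_mul_atTop (sub_pos.2 hba)).eventually_gt_atTop C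
  obtain ⟨n, hn, hC, hK⟩ :=
    ((frequently_K_le_mul_of_effDim_lt hXb).and_eventually (hlarge.and h)).exists
  linarith

theorem effDim_le (C : ℝ) (h : ∃ᶠ n : ℕ in atTop, (K (prefixOf X n) : ℝ) ≤ a * n + C) :
    effDim X ≤ a := by
  by_contra! hlt
  obtain ⟨b, hab, hbX⟩ := exists_between hlt
  have hlarge : ∀ᶠ n : ℕ in atTop, C < (b - a) * n :=
    (tendsto_natCast_atTop_atTop.const_mul_atTop (sub_pos.2 hab)).eventually_gt_atTop C
  obtain ⟨n, hK, hC, hn⟩ :=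
    (h.and_eventually (hlarge.and (eventually_mul_le_K_of_lt_effDim hbX))).exists
  linarith

theorem effDim_le_one (X : ℕ → Bool) : effDim X ≤ 1 := by
  obtain ⟨c, hc⟩ := exists_K_le_length_add_sqrt
  refine le_of_forall_pos_le_add fun ε hε => effDim_le c (Eventually.frequently ?_)
  have hsqrt : ∀ᶠ n : ℕ in atTop, 2 / ε ≤ √(n : ℝ) :=
    (Real.tendsto_sqrt_atTop.comp tendsto_natCast_atTop_atTop).eventually_ge_atTop _
  filter_upwards [hsqrt] with n hn
  have hK : (K (prefixOf X n) : ℝ) ≤ n + 2 * Nat.sqrt n + c := by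
    have := hc (prefixOf X n)
    rw [length_prefixOf] at this
    exact_mod_cast this
  have hε_sqrt : 2 * √(n : ℝ) ≤ ε * n := by
    calc 2 * √(n : ℝ) ≤ ε * √n * √n := by gcongr; rwa [← div_le_iff₀' hε]
      _ = ε * n := by rw [mul_assoc, Real.mul_self_sqrt n.cast_nonneg]
  linarith [Real.nat_sqrt_le_real_sqrt (a := n)]

theorem IsMLRandom.effDim_eq_one (hZ : IsMLRandom Z) : effDim Z = 1 := by
  obtain ⟨c, hc⟩ := hZ
  refine le_antisymm (effDim_le_one Z) (le_effDim c (Eventually.of_forall fun n => ?_))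
  rw [one_mul]
  exact_mod_cast hc n

theorem eventually_half_mul_le_K_prefixOf_half (h : a < effDim Z) :
    ∀ᶠ n : ℕ in atTop, a / 2 * n ≤ K (prefixOf Z (n / 2)) + |a| / 2 := by
  have hhalf : Tendsto (fun n : ℕ => n / 2) atTop atTop :=
    Nat.tendsto_div_const_atTop two_ne_zero
  filter_upwards [hhalf.eventually (eventually_mul_le_K_of_lt_effDim h)] with n hn
  have hle : ((n / 2 : ℕ) : ℝ) ≤ n / 2 := Nat.cast_div_le
  have hlt : (n : ℝ) ≤ 2 * (n / 2 : ℕ) + 1 := by exact_mod_cast (by omega)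
  have : a * (n / 2 - (n / 2 : ℕ)) ≤ |a| * (1 / 2) :=
    mul_le_mul (le_abs_self a) (by linarith) (by linarith) (abs_nonneg a)
  linarith

end Dimension

/-! ### The join of a sequence with itself -/

theorem exists_K_prefixOf_comp_le {g m : ℕ → ℕ} (hg : Primrec g) (hm : Primrec m)
    (hgm : ∀ n, ∀ i < m n, g i < n) :
    ∃ c : ℕ, ∀ (X : ℕ → Bool) (n : ℕ),
      K (prefixOf (fun i => X (g i)) (m n)) ≤ K (prefixOf X n) + c := by
  have hF : Primrec fun x : List Bool => prefixOf (fun i => x.getD (g i) false) (m x.length) :=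
    Primrec.list_map (Primrec.list_range.comp (hm.comp Primrec.list_length))
      ((Primrec.list_getD false).comp Primrec.fst (hg.comp Primrec.snd))
  obtain ⟨c, hc⟩ := exists_K_map_le hF.to_comp
  refine ⟨c, fun X n => ?_⟩
  have hcomp : prefixOf (fun i => X (g i)) (m n) =
      prefixOf (fun i => (prefixOf X n).getD (g i) false) (m (prefixOf X n).length) := by
    rw [length_prefixOf, prefixOf_inj]
    exact fun i hi => (getD_prefixOf (hgm n i hi) false).symm
  rw [hcomp]
  exact hc (prefixOf X n)

theorem join_two_mul (X Y : ℕ → Bool) (i : ℕ) : join X Y (2 * i) = X i := by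
  simp [join]

theorem join_two_mul_add_one (X Y : ℕ → Bool) (i : ℕ) : join X Y (2 * i + 1) = Y i := by
  simp [join, Nat.add_mod, Nat.mul_add_div]

theorem exists_K_le_K_join_left :
    ∃ c : ℕ, ∀ (X Y : ℕ → Bool) (n : ℕ),
      K (prefixOf X (n / 2)) ≤ K (prefixOf (join X Y) n) + c := by
  obtain ⟨c, hc⟩ := exists_K_prefixOf_comp_le (g := fun i => 2 * i) (m := fun n => n / 2)
    (Primrec.nat_mul.comp (Primrec.const 2) Primrec.id)
    (Primrec.nat_div.comp Primrec.id (Primrec.const 2)) (by omega)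
  exact ⟨c, fun X Y n => by simpa only [join_two_mul] using hc (join X Y) n⟩

theorem exists_K_join_self_le_K :
    ∃ c : ℕ, ∀ (Z : ℕ → Bool) (n : ℕ),
      K (prefixOf (join Z Z) (2 * n)) ≤ K (prefixOf Z n) + c := by
  obtain ⟨c, hc⟩ := exists_K_prefixOf_comp_le (g := fun i => i / 2) (m := fun n => 2 * n)
    (Primrec.nat_div.comp Primrec.id (Primrec.const 2))
    (Primrec.nat_mul.comp (Primrec.const 2) Primrec.id) (by omega)
  have join_self (Z : ℕ → Bool) : join Z Z = fun i => Z (i / 2) := funext fun _ => ite_self _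
  exact ⟨c, fun Z n => by simpa only [join_self] using hc Z n⟩

theorem effDim_join_self (Z : ℕ → Bool) : effDim (join Z Z) = effDim Z / 2 := by
  apply le_antisymm
  · obtain ⟨c, hc⟩ := exists_K_join_self_le_K
    rw [le_div_iff₀ two_pos]
    refine le_of_forall_gt_imp_ge_of_dense fun b hb => ?_
    rw [← le_div_iff₀ two_pos]
    have hdouble : Tendsto (fun n : ℕ => 2 * n) atTop atTop :=
      tendsto_id.const_mul_atTop' two_pos
    refine effDim_le c (hdouble.frequently
      ((frequently_K_le_mul_of_effDim_lt hb).mono fun n hn => ?_))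
    have : (K (prefixOf (join Z Z) (2 * n)) : ℝ) ≤ K (prefixOf Z n) + c := by
      exact_mod_cast hc Z n
    push_cast
    linarith
  · obtain ⟨c, hc⟩ := exists_K_le_K_join_left
    rw [div_le_iff₀ two_pos]
    refine le_of_forall_lt_imp_le_of_dense fun a ha => ?_
    rw [← div_le_iff₀ two_pos]
    refine le_effDim (c + |a| / 2) ?_
    filter_upwards [eventually_half_mul_le_K_prefixOf_half ha] with n hn
    have : (K (prefixOf Z (n / 2)) : ℝ) ≤ K (prefixOf (join Z Z) n) + c := by
      exact_mod_cast hc Z Z n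
    linarith

/-! ### Coding relative to an approximation -/

/-- A prefix code for pairs of bits that favours `(false, false)`. -/
def pairCode (u v : Bool) : List Bool := if u || v then [true, u, v] else [false]

/-- A code for strings with few `true` entries, obtained by applying `pairCode` to consecutive pairs
of bits; among strings of the same length it is prefix-free. A string of odd length is padded with
`false`. -/
def sparseCode : List Bool → List Bool
  | [] => []
  | [u] => pairCode u false
  | u :: v :: e => pairCode u v ++ sparseCode e

theorem pairCode_append_prefix_append {u v u' v' : Bool} {s s' : List Bool}
    (h : pairCode u v ++ s <+: pairCode u' v' ++ s') : u = u' ∧ v = v' ∧ s <+: s' := by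
  cases u <;> cases v <;> cases u' <;> cases v' <;> simp_all [pairCode]

theorem length_pairCode_le (u v : Bool) :
    (pairCode u v).length ≤ 1 + 2 * (List.count true [u, v]) := by
  cases u <;> cases v <;> decide

theorem length_sparseCode_le (e : List Bool) :
    (sparseCode e).length ≤ (e.length + 1) / 2 + 2 * e.count true := by
  match e with
  | [] => simp [sparseCode]
  | [u] => cases u <;> decide
  | u :: v :: e =>
    have hpair := length_pairCode_le u v
    have ih := length_sparseCode_le e
    have hcount : (u :: v :: e).count true = [u, v].count true + e.count true :=
      List.count_append (l₁ := [u, v])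
    simp only [sparseCode, List.length_append, List.length_cons, hcount]
    omega

theorem eq_of_prefix_sparseCode :
    ∀ {e e' : List Bool}, e.length = e'.length → sparseCode e <+: sparseCode e' → e = e'
  | [], [], _, _ => rfl
  | [u], [u'], _, h => by
    obtain ⟨rfl, -, -⟩ : u = u' ∧ false = false ∧ [] <+: [] :=
      pairCode_append_prefix_append (by simpa only [sparseCode, List.append_nil] using h)
    rfl
  | u :: v :: e, u' :: v' :: e', hlen, h => by
    obtain ⟨rfl, rfl, htail⟩ := pairCode_append_prefix_append h
    have hlen' : e.length = e'.length := by simpa using hlen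
    rw [eq_of_prefix_sparseCode hlen' htail]

theorem sparseCode_eq_flatMap (e : List Bool) :
    sparseCode e = (List.range ((e.length + 1) / 2)).flatMap fun i =>
      pairCode (e.getD (2 * i) false) (e.getD (2 * i + 1) false) := by
  match e with
  | [] => simp [sparseCode]
  | [u] => simp [sparseCode]
  | u :: v :: e =>
    have hlen : ((u :: v :: e).length + 1) / 2 = (e.length + 1) / 2 + 1 := by
      simp only [List.length_cons]; omega
    rw [hlen, List.range_succ_eq_map, List.flatMap_cons, List.flatMap_map, sparseCode,
      sparseCode_eq_flatMap e]
    rfl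

theorem sparseCode_primrec : Primrec sparseCode := by
  have getD_mul_add (d : ℕ) : Primrec₂ fun (e : List Bool) (i : ℕ) => e.getD (2 * i + d) false :=
    (Primrec.list_getD false).comp Primrec.fst (Primrec.nat_add.comp
      (Primrec.nat_mul.comp (Primrec.const 2) Primrec.snd) (Primrec.const d))
  have half_length : Primrec fun e : List Bool => (e.length + 1) / 2 :=
    Primrec.nat_div.comp (Primrec.succ.comp Primrec.list_length) (Primrec.const 2)
  exact (Primrec.list_flatMap (Primrec.list_range.comp half_length)
    ((Primrec.dom_bool₂ pairCode).comp₂ (getD_mul_add 0) (getD_mul_add 1))).of_eq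
    fun e => (sparseCode_eq_flatMap e).symm

theorem count_true_prefixOf (E : ℕ → Bool) (n : ℕ) :
    (prefixOf E n).count true = Nat.count (fun k => E k = true) n := by
  induction n with
  | zero => rfl
  | succ n ih =>
    have hsucc : prefixOf E (n + 1) = prefixOf E n ++ [E n] := by
      simp [prefixOf, List.range_succ]
    rw [hsucc, List.count_append, ih, Nat.count_succ]
    cases E n <;> rfl

/-- The characteristic string of the places at which `z` differs from `x`, for `z` of the same
length as `x`. -/
def mismatches (x z : List Bool) : List Bool :=
  prefixOf (fun i => xor (x.getD i false) (z.getD i false)) x.length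

theorem mismatches_primrec : Primrec₂ mismatches := by
  have getD_fst : Primrec₂ fun (p : List Bool × List Bool) (i : ℕ) => p.1.getD i false :=
    (Primrec.list_getD false).comp (Primrec.fst.comp Primrec.fst) Primrec.snd
  have getD_snd : Primrec₂ fun (p : List Bool × List Bool) (i : ℕ) => p.2.getD i false :=
    (Primrec.list_getD false).comp (Primrec.snd.comp Primrec.fst) Primrec.snd
  exact Primrec.list_map (Primrec.list_range.comp (Primrec.list_length.comp Primrec.fst))
    ((Primrec.dom_bool₂ xor).comp₂ getD_fst getD_snd)

theorem eq_of_mismatches_eq {x z z' : List Bool} (hz : z.length = x.length)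
    (hz' : z'.length = x.length) (h : mismatches x z = mismatches x z') : z = z' := by
  rw [mismatches, mismatches, prefixOf_inj] at h
  refine List.ext_getElem (hz.trans hz'.symm) fun i hi hi' => ?_
  simpa [hi, hi'] using h i (hz ▸ hi)

theorem mismatches_prefixOf (X Z : ℕ → Bool) (n : ℕ) :
    mismatches (prefixOf X n) (prefixOf Z n) = prefixOf (fun k => xor (X k) (Z k)) n := by
  rw [mismatches, length_prefixOf, prefixOf_inj]
  exact fun i hi => by rw [getD_prefixOf hi, getD_prefixOf hi]

theorem length_sparseCode_mismatches_le (X Z : ℕ → Bool) (n : ℕ) :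
    (sparseCode (mismatches (prefixOf X n) (prefixOf Z n))).length ≤
      (n + 1) / 2 + 2 * Nat.count (fun k => X k ≠ Z k) n := by
  have h := length_sparseCode_le (mismatches (prefixOf X n) (prefixOf Z n))
  simpa only [mismatches_prefixOf, count_true_prefixOf, length_prefixOf, bne_iff_ne] using h

theorem exists_K_le_K_add_count_ne :
    ∃ c : ℕ, ∀ (X Z : ℕ → Bool) (n : ℕ), K (prefixOf Z n) ≤
      K (prefixOf X n) + (n + 1) / 2 + 2 * Nat.count (fun k => X k ≠ Z k) n + c := by
  let code (x z : List Bool) : Option (List Bool) :=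
    if z.length = x.length then some (sparseCode (mismatches x z)) else none
  have code_primrec : Primrec₂ code :=
    Primrec.ite (Primrec.eq.comp (Primrec.list_length.comp Primrec.snd)
      (Primrec.list_length.comp Primrec.fst))
      (Primrec.option_some.comp (sparseCode_primrec.comp mismatches_primrec)) (Primrec.const none)
  have code_prefixFree (x z z' r r' : List Bool) (hr : code x z = some r)
      (hr' : code x z' = some r') (hpre : r <+: r') : z = z' := by
    simp only [code, Option.ite_none_right_eq_some, Option.some.injEq] at hr hr'
    obtain ⟨hz, rfl⟩ := hr
    obtain ⟨hz', rfl⟩ := hr'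
    exact eq_of_mismatches_eq hz hz' (eq_of_prefix_sparseCode (by simp [mismatches]) hpre)
  obtain ⟨c, hc⟩ := exists_K_le_K_add_length_code code_primrec.to_comp code_prefixFree
  refine ⟨c, fun X Z n => ?_⟩
  have hcode := hc (prefixOf X n) (prefixOf Z n) _ (if_pos (by simp only [length_prefixOf]))
  have hlen := length_sparseCode_mismatches_le X Z n
  omega

theorem count_ne_join_two_mul (X Z W : ℕ → Bool) (m : ℕ) :
    Nat.count (fun k => X k ≠ join Z W k) (2 * m) =
      Nat.count (fun i => X (2 * i) ≠ Z i) m + Nat.count (fun i => X (2 * i + 1) ≠ W i) m := by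
  induction m with
  | zero => rfl
  | succ m ih =>
    simp only [Nat.mul_succ, Nat.count_succ, ih, join_two_mul, join_two_mul_add_one]
    omega

theorem exists_two_mul_K_half_le :
    ∃ c : ℕ, ∀ (X Z : ℕ → Bool) (n : ℕ), 2 * K (prefixOf Z (n / 2)) ≤
      2 * K (prefixOf X n) + n / 2 + 2 * Nat.count (fun k => X k ≠ join Z Z k) n + c := by
  have hhalf : Primrec fun n : ℕ => n / 2 := Primrec.nat_div.comp Primrec.id (Primrec.const 2)
  have hdouble : Primrec fun i : ℕ => 2 * i := Primrec.nat_mul.comp (Primrec.const 2) Primrec.id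
  obtain ⟨c₀, heven⟩ := exists_K_prefixOf_comp_le hdouble hhalf (by omega)
  obtain ⟨c₁, hodd⟩ := exists_K_prefixOf_comp_le (Primrec.succ.comp hdouble) hhalf (by omega)
  obtain ⟨c, hc⟩ := exists_K_le_K_add_count_ne
  refine ⟨c₀ + c₁ + 2 * c + 1, fun X Z n => ?_⟩
  have hsplit := count_ne_join_two_mul X Z Z (n / 2)
  have hmono := Nat.count_monotone (fun k => X k ≠ join Z Z k) (Nat.mul_div_le n 2)
  have h₀ := hc (fun i => X (2 * i)) Z (n / 2)
  have h₁ := hc (fun i => X (2 * i + 1)) Z (n / 2)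
  have h₀' := heven X n
  have h₁' := hodd X n
  simp only [Nat.succ_eq_add_one] at h₁'
  omega

theorem eventually_count_ne_le_of_besicovitchDist_lt {X Y : ℕ → Bool} {b : ℝ}
    (h : besicovitchDist X Y < b) :
    ∀ᶠ n : ℕ in atTop, (Nat.count (fun k => X k ≠ Y k) n : ℝ) ≤ b * n := by
  have hbdd : IsBoundedUnder (· ≤ ·) atTop fun n : ℕ =>
      (((Finset.range n).filter fun k => X k ≠ Y k).card : ℝ) / n := by
    refine isBoundedUnder_of_eventually_le (a := 1) (Eventually.of_forall fun n => ?_)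
    have : ((Finset.range n).filter fun k => X k ≠ Y k).card ≤ n := by
      simpa using Finset.card_filter_le (Finset.range n) fun k => X k ≠ Y k
    exact div_le_one_of_le₀ (by exact_mod_cast this) n.cast_nonneg
  filter_upwards [eventually_lt_of_limsup_lt h hbdd, eventually_gt_atTop 0] with n hn hpos
  rw [Nat.count_eq_card_filter_range]
  exact ((div_lt_iff₀ (by positivity)).1 hn).le

theorem half_effDim_le_effDim_add_besicovitchDist (X Z : ℕ → Bool) :
    effDim Z / 2 ≤ effDim X + besicovitchDist X (join Z Z) + 1 / 4 := by
  obtain ⟨c, hc⟩ := exists_two_mul_K_half_le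
  have approx {a b : ℝ} (ha : a < effDim Z) (hb : besicovitchDist X (join Z Z) < b) :
      a / 2 - b - 1 / 4 ≤ effDim X := by
    refine le_effDim (c / 2 + |a| / 2) ?_
    filter_upwards [eventually_half_mul_le_K_prefixOf_half ha,
      eventually_count_ne_le_of_besicovitchDist_lt hb] with n hZ hcount
    have hK : 2 * (K (prefixOf Z (n / 2)) : ℝ) ≤ 2 * K (prefixOf X n) + (n / 2 : ℕ) +
        2 * Nat.count (fun k => X k ≠ join Z Z k) n + c := by exact_mod_cast hc X Z n
    have hn : ((n / 2 : ℕ) : ℝ) ≤ n / 2 := Nat.cast_div_le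
    linarith
  refine le_of_forall_pos_le_add fun ε hε => ?_
  linarith [approx (sub_lt_self _ hε) (lt_add_of_pos_right _ (half_pos hε))]

theorem IsMLRandom.quarter_le_effDim_add_besicovitchDist {Z : ℕ → Bool} (hZ : IsMLRandom Z)
    (X : ℕ → Bool) : 1 / 4 ≤ effDim X + besicovitchDist X (join Z Z) := by
  linarith [half_effDim_le_effDim_add_besicovitchDist X Z, hZ.effDim_eq_one]

/-! ### The entropy function -/

theorem H_eq_binEntropy_div_log_two (p : ℝ) : H p = Real.binEntropy p / Real.log 2 := by
  rw [Real.binEntropy_eq_negMulLog_add_negMulLog_one_sub]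
  simp only [H, Real.logb, Real.negMulLog]
  ring

theorem strictMonoOn_H : StrictMonoOn H (Set.Icc 0 (1 / 2)) := by
  intro p hp q hq hpq
  rw [one_div] at hp hq
  simp only [H_eq_binEntropy_div_log_two]
  exact div_lt_div_of_pos_right (Real.binEntropy_strictMonoOn hp hq hpq) (Real.log_pos one_lt_two)

theorem surjOn_H : Set.SurjOn H (Set.Icc 0 (1 / 2)) (Set.Icc 0 1) := by
  have hcont : Continuous H := by
    rw [funext H_eq_binEntropy_div_log_two]
    exact Real.binEntropy_continuous.div_const _
  have hzero : H 0 = 0 := by simp [H]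
  have hhalf : H (1 / 2) = 1 := by
    rw [H_eq_binEntropy_div_log_two, one_div, Real.binEntropy_two_inv,
      div_self (Real.log_pos one_lt_two).ne']
  have hivt := intermediate_value_Icc (show (0 : ℝ) ≤ 1 / 2 by norm_num) hcont.continuousOn
  rwa [hzero, hhalf] at hivt

theorem Hinv_lt_of_lt_H {p y : ℝ} (hp : p ∈ Set.Icc 0 (1 / 2)) (hy : y ∈ Set.Icc 0 1)
    (h : y < H p) : Hinv y < p := by
  have hmem : Hinv y ∈ Set.Icc 0 (1 / 2) := Function.invFunOn_mem (surjOn_H hy)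
  have hval : H (Hinv y) = y := Function.invFunOn_eq (surjOn_H hy)
  rwa [← strictMonoOn_H.lt_iff_lt hmem hp, hval]

theorem half_lt_H_quarter : 1 / 2 < H (1 / 4) := by
  have hlog₄ : Real.log 4 = 2 * Real.log 2 := by
    rw [show (4 : ℝ) = 2 ^ 2 by norm_num, Real.log_pow, Nat.cast_ofNat]
  have hent : Real.binEntropy (1 / 4) = 1 / 2 * Real.log 2 + 3 / 4 * Real.log (4 / 3) := by
    rw [Real.binEntropy, show (1 / 4 : ℝ)⁻¹ = 4 by norm_num,
      show (1 - 1 / 4 : ℝ)⁻¹ = 4 / 3 by norm_num, hlog₄]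
    ring
  rw [H_eq_binEntropy_div_log_two, lt_div_iff₀ (Real.log_pos one_lt_two), hent]
  linarith [Real.log_pos (show (1 : ℝ) < 4 / 3 by norm_num)]

theorem Hinv_half_lt_quarter : Hinv (1 / 2) < 1 / 4 :=
  Hinv_lt_of_lt_H (by norm_num) (by norm_num) half_lt_H_quarter

end EffDim

theorem mainTheorem8 :
    ∃ Y : ℕ → Bool,
      (∃ Z : ℕ → Bool, EffDim.IsMLRandom Z ∧ Y = EffDim.join Z Z) ∧
      EffDim.effDim Y = 1 / 2 ∧
      (∀ X : ℕ → Bool, EffDim.besicovitchDist X Y ≤ EffDim.Hinv (1 / 2) → 0 < EffDim.effDim X) ∧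
      (∀ X : ℕ → Bool, EffDim.effDim X = 0 →
        EffDim.Hinv |EffDim.effDim Y - EffDim.effDim X| < EffDim.besicovitchDist X Y) := by
  obtain ⟨Z, hZ⟩ := EffDim.exists_isMLRandom
  have hdim : EffDim.effDim (EffDim.join Z Z) = 1 / 2 := by
    rw [EffDim.effDim_join_self, hZ.effDim_eq_one]
  have hpos (X : ℕ → Bool) (hX : EffDim.besicovitchDist X (EffDim.join Z Z) ≤ EffDim.Hinv (1 / 2)) :
      0 < EffDim.effDim X := by
    linarith [hZ.quarter_le_effDim_add_besicovitchDist X, EffDim.Hinv_half_lt_quarter]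
  refine ⟨EffDim.join Z Z, ⟨Z, hZ, rfl⟩, hdim, hpos, fun X hX => ?_⟩
  rw [hdim, hX, sub_zero, abs_of_pos one_half_pos]
  by_contra! hle
  exact (hpos X hle).ne' hX
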